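/- Consider a DC power grid with $n\ge 1$ load nodes and $m\ge 1$ source nodes, whose lines between nodes $i\sim j$ have conductances $w_{ij}=w_{ji}>0$. Assume that the graph of nodes and lines is connected and that the load nodes with the lines between them also form a connected graph. Let $Y\in\mathbb R^{(n+m)\times(n+m)}$ be the Kirchhoff matrix, i.e. $Y_{ii}=\sum_{k\sim i}w_{ik}$, $Y_{ij}=-w_{ij}$ if $i\ne j$ and $i\sim j$, and $Y_{ij}=0$ otherwise, partitioned into blocks $Y_{LL},Y_{LS},Y_{SL},Y_{SS}$ according to loads and sources. Let $V_S\in\mathbb R^m$ be the fixed vector of source voltages, with $V_S>0$ (vector inequalities are element-wise), let $V_L^*:=-Y_{LL}^{-1}Y_{LS}V_S$, and for $V_L\in\mathbb R^n$ let $$P_c(V_L):=[V_L]\,Y_{LL}\,(V_L^*-V_L),\qquad [x]:=\operatorname{diag}(x_1,\dots,x_n).$$ A vector $V_L>0$ is an operating point associated to $P\in\mathbb R^n$ if $[V_L]Y_{LL}(V_L-V_L^*)+P=0$, and $\mathcal F\subset\mathbb R^n$ is the set of feasible power demands, i.e. of all $P$ that have an associated operating point. An operating point $V_L$ is long-term voltage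 stable if the Jacobian $\frac{\partial P_c}{\partial V_L}(V_L)$ is nonsingular and all entries of its inverse are negative; $\mathcal D$ is the set of all such points. An operating point is long-term voltage semi-stable if there are long-term voltage stable operating points arbitrarily close to it in the Euclidean norm. Then the set of long-term voltage semi-stable operating points is the closure $\operatorname{cl}\mathcal D$, and $P_c$ restricts to a bijection from $\operatorname{cl}\mathcal D$ onto $\mathcal F$: for each $\tilde P_c\in\mathcal F$ there is exactly one $\tilde V_L\in\operatorname{cl}\mathcal D$ with $\tilde P_c=P_c(\tilde V_L)$, and $\mathcal F=P_c(\operatorname{cl}\mathcal D)$. Moreover, for each $\tilde P_c\in\mathcal F$ the initial value problem $$\dot\gamma(\theta)=\Big(\frac{\partial P_c}{\partial V_L}(\gamma(\theta))\Big)^{-1}\tilde P_c,\qquad \gamma(0)=V_L^*,$$ has exactly one solution $\gamma:[0,1]\to\mathbb R^n$, and it satisfies $\gamma(1)=\tilde V_L$. Here a solution is a continuous $\gamma:[0,1]\to\mathbb R^n$ with $\gamma(0)=V_L^*$ such that for every $\theta\in[0,1)$ the Jacobian $\frac{\partial P_c}{\partial V_L}(\gamma(\theta))$ is nonsingular and the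 differential equation holds at $\theta$. If $\tilde P_c$ lies in the interior of $\mathcal F$, then the Jacobian at $\gamma(1)$ is nonsingular and the differential equation holds at $\theta=1$ as well. (Derivatives at the endpoints of $[0,1]$ are one-sided.) -/

import Mathlib

open Matrix Set

noncomputable section

/-- A DC power grid with `n` load nodes (`Sum.inl`) and `m ≥ 1` source nodes (`Sum.inr`),
whose lines have positive conductances, whose graph is connected, whose load nodes
(with the lines between them) form a connected graph, and whose sources have fixed
positive voltage potentials `VS`. -/
structure DCGrid (n m : ℕ) where
  /-- `graph.Adj i j` means that there is a line between `i` and `j`. -/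
  graph : SimpleGraph (Fin n ⊕ Fin m)
  /-- The conductances; only the values on lines matter. -/
  w : Fin n ⊕ Fin m → Fin n ⊕ Fin m → ℝ
  w_symm : ∀ i j, w i j = w j i
  w_pos : ∀ i j, graph.Adj i j → 0 < w i j
  connected : graph.Connected
  loads_connected : (graph.comap (Sum.inl : Fin n → Fin n ⊕ Fin m)).Connected
  sources_nonempty : 0 < m
  /-- The voltage potentials at the sources. -/
  VS : Fin m → ℝ
  VS_pos : ∀ k, 0 < VS k

namespace DCGrid

variable {n m : ℕ} (G : DCGrid n m)

open Classical in
/-- The Kirchhoff matrix. -/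
def Y : Matrix (Fin n ⊕ Fin m) (Fin n ⊕ Fin m) ℝ :=
  Matrix.of fun i j =>
    if i = j then ∑ k with G.graph.Adj k i, G.w i k
    else if G.graph.Adj i j then -G.w i j
    else 0

/-- The load-load block of the Kirchhoff matrix. -/
def YLL : Matrix (Fin n) (Fin n) ℝ := G.Y.toBlocks₁₁

/-- The load-source block of the Kirchhoff matrix. -/
def YLS : Matrix (Fin n) (Fin m) ℝ := G.Y.toBlocks₁₂

/-- The open-circuit voltages `V_L^* = -Y_LL⁻¹ Y_LS V_S`. -/
def Vopen : Fin n → ℝ := -(G.YLL⁻¹ *ᵥ (G.YLS *ᵥ G.VS))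

/-- The vector of constant power demands that is satisfied by the load voltages `V`:
`P_c(V) = [V] Y_LL (V_L^* - V)`. -/
def Pc (V : Fin n → ℝ) : Fin n → ℝ :=
  Matrix.diagonal V *ᵥ (G.YLL *ᵥ (G.Vopen - V))

/-- `V` is an operating point associated to the power demand `P`: `V` is positive and solves
the power flow equation `[V] Y_LL (V - V_L^*) + P = 0`. -/
def IsOperatingPoint (V P : Fin n → ℝ) : Prop :=
  (∀ i, 0 < V i) ∧ Matrix.diagonal V *ᵥ (G.YLL *ᵥ (V - G.Vopen)) + P = 0

/-- The set of feasible power demands. -/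
def F : Set (Fin n → ℝ) := {P | ∃ V, G.IsOperatingPoint V P}

/-- The Jacobian matrix of `P_c` at `V`. -/
def jacobian (V : Fin n → ℝ) : Matrix (Fin n) (Fin n) ℝ :=
  LinearMap.toMatrix' (fderiv ℝ G.Pc V : (Fin n → ℝ) →ₗ[ℝ] (Fin n → ℝ))

/-- The operating point `V` associated to `P` is long-term voltage stable: the Jacobian of `P_c`
at `V` is nonsingular and all entries of its inverse are negative. -/
def IsStable (V P : Fin n → ℝ) : Prop :=
  G.IsOperatingPoint V P ∧ IsUnit (G.jacobian V).det ∧ ∀ i j, (G.jacobian V)⁻¹ i j < 0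

/-- The set of all long-term voltage stable operating points. -/
def D : Set (Fin n → ℝ) := {V | ∃ P, G.IsStable V P}

/-- The operating point `V` associated to `P` is long-term voltage semi-stable: there are
long-term voltage stable operating points arbitrarily close to it in the Euclidean norm. -/
def IsSemiStable (V P : Fin n → ℝ) : Prop :=
  G.IsOperatingPoint V P ∧
    ∀ ε > 0, ∃ W Q, G.IsStable W Q ∧ ‖WithLp.toLp 2 (V - W)‖ < ε

/-- At time `θ`, the Jacobian of `P_c` at `γ θ` is nonsingular and the path `γ` on `[0, 1]`
satisfies `γ' = (∂P_c/∂V_L (γ))⁻¹ P` (with one-sided derivatives at `0` and `1`). -/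
def SolvesODEAt (P : Fin n → ℝ) (γ : ℝ → Fin n → ℝ) (θ : ℝ) : Prop :=
  IsUnit (G.jacobian (γ θ)).det ∧
    HasDerivWithinAt γ ((G.jacobian (γ θ))⁻¹ *ᵥ P) (Icc 0 1) θ

/-- `γ` solves the initial value problem `γ' = (∂P_c/∂V_L (γ))⁻¹ P`, `γ 0 = V_L^*` on `[0, 1]`:
it is continuous on `[0, 1]` and satisfies the differential equation on `[0, 1)`. The endpoint is
excluded because the Jacobian of `P_c` is singular at `γ 1` when `P` is a boundary point of `F`. -/
structure IsIVPSolution (P : Fin n → ℝ) (γ : ℝ → Fin n → ℝ) : Prop where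
  continuousOn : ContinuousOn γ (Icc 0 1)
  initial : γ 0 = G.Vopen
  ode : ∀ θ ∈ Ico (0 : ℝ) 1, G.SolvesODEAt P γ θ

end DCGrid

end

/-! Let `A = Y_LL` and `b = A V_L^*`. The central object is the symmetric matrix `S(V) = [V] A [V] -
[P_c(V)]`, which is minus the Jacobian times `[V]`. For `V > 0` it has nonpositive off-diagonal
entries and a connected graph, so Perron–Frobenius applies: `D` consists of the `V > 0` with `S(V)`
positive definite, and `cl D` of those with `S(V)` positive semidefinite (`D_eq_stableSet`,
`closure_stableSet`).

At `V` in `cl D` take the Perron vector `y > 0` of `S(V)`, with eigenvalue `μ ≥ 0`. The weighted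
total power `∑ y i * P_c i` is a strictly concave quadratic with gradient `-μ y / V` at `V`
(`exists_sum_powerMap_le`), so no other `W ≥ V` draws at least as much power at every node.
Injectivity follows by comparing `V` and `W` with `V ⊔ W`. For surjectivity, a maximal voltage
vector drawing at least `P` draws exactly `P` and lies in `cl D` (`exists_mem_semistableSet`).

The powers are concave in the squared voltages, so the segment from `0` to a feasible `P` is
feasible. Its lift to `cl D` is continuous by compactness and stays in `D` before the endpoint, so
the inverse function theorem turns it into a solution. Conversely, every solution satisfies `P_c (γ
θ) = θ P` and cannot leave `D` before time `1`, as the Jacobian stays nonsingular; injectivity then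
gives uniqueness. -/

/-! ### Symmetric irreducible Z-matrices -/

/-- A symmetric matrix with nonpositive off-diagonal entries that are negative along the edges
of the graph `H`. -/
structure IsZMatrixOn {ι : Type*} (H : SimpleGraph ι) (S : Matrix ι ι ℝ) : Prop where
  symm : ∀ i j, S i j = S j i
  nonpos : ∀ i j, i ≠ j → S i j ≤ 0
  neg : ∀ i j, H.Adj i j → S i j < 0

theorem SimpleGraph.Connected.forall_of_adj {ι : Type*} {H : SimpleGraph ι} (hH : H.Connected)
    {p : ι → Prop} (hp : ∀ i j, H.Adj i j → p i → p j) {i : ι} (hi : p i) (j : ι) : p j := by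
  obtain ⟨w⟩ := hH.preconnected i j
  induction w with
  | nil => exact hi
  | cons h _ ih => exact ih (hp _ _ h hi)

namespace IsZMatrixOn

variable {ι : Type*} [Fintype ι] {H : SimpleGraph ι} {S : Matrix ι ι ℝ}

theorem dotProduct_mulVec_comm (hS : IsZMatrixOn H S) (x y : ι → ℝ) :
    x ⬝ᵥ S *ᵥ y = y ⬝ᵥ S *ᵥ x := by
  simp only [dotProduct, mulVec, Finset.mul_sum]
  rw [Finset.sum_comm]
  refine Finset.sum_congr rfl fun i _ => Finset.sum_congr rfl fun j _ => ?_
  rw [hS.symm j i]; ring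

/-- A nonnegative vector with `(S x) i ≥ 0` wherever `x i = 0` is zero or positive. -/
theorem pos_or_eq_zero (hH : H.Connected) (hS : IsZMatrixOn H S) {x : ι → ℝ}
    (hx : ∀ i, 0 ≤ x i) (h : ∀ i, x i = 0 → 0 ≤ (S *ᵥ x) i) : (∀ i, 0 < x i) ∨ x = 0 := by
  by_contra! hc
  obtain ⟨⟨i, hi⟩, hne⟩ := hc
  have hi0 : x i = 0 := le_antisymm hi (hx i)
  refine hne (funext fun j => ?_)
  -- At a zero `k` of `x` all terms of `(S x) k` are nonpositive, yet the sum is not negative; so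
  -- all vanish, and zeros spread along edges.
  refine hH.forall_of_adj (p := fun k => x k = 0) (fun k l hkl hk => ?_) hi0 j
  have hterm : ∀ j ∈ Finset.univ, 0 ≤ -(S k j * x j) := fun j _ => by
    by_cases hjk : k = j
    · subst hjk; simp [hk]
    · nlinarith [hS.nonpos k j hjk, hx j]
  have hsum : ∑ j, -(S k j * x j) = 0 := by
    refine le_antisymm ?_ (Finset.sum_nonneg hterm)
    have := h k hk
    simp only [mulVec, dotProduct] at this
    rw [Finset.sum_neg_distrib]; linarith
  have := (Finset.sum_eq_zero_iff_of_nonneg hterm).1 hsum l (Finset.mem_univ l)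
  have h2 := hS.neg k l hkl
  rcases mul_eq_zero.1 (neg_eq_zero.1 this) with h3 | h3
  · exact absurd h3 h2.ne
  · exact h3

/-- Perron–Frobenius for symmetric matrices with nonpositive off-diagonal entries. -/
theorem exists_perron (hH : H.Connected) (hS : IsZMatrixOn H S) :
    ∃ (y : ι → ℝ) (μ : ℝ), (∀ i, 0 < y i) ∧ S *ᵥ y = μ • y ∧
      ∀ x, μ * (x ⬝ᵥ x) ≤ x ⬝ᵥ S *ᵥ x := by
  classical
  obtain ⟨i₀⟩ := hH.nonempty
  have hcd : Continuous fun x : ι → ℝ => x ⬝ᵥ x := by unfold dotProduct; fun_prop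
  have hcq : Continuous fun x : ι → ℝ => x ⬝ᵥ S *ᵥ x := by
    simp only [dotProduct, mulVec]; fun_prop
  have hK : IsCompact {x : ι → ℝ | x ⬝ᵥ x = 1} := by
    refine Metric.isCompact_of_isClosed_isBounded (isClosed_eq hcd continuous_const) ?_
    refine (Metric.isBounded_closedBall (x := (0 : ι → ℝ)) (r := 1)).subset fun x hx => ?_
    rw [mem_closedBall_zero_iff, pi_norm_le_iff_of_nonneg zero_le_one]
    intro i
    have h1 : x i * x i ≤ x ⬝ᵥ x :=
      Finset.single_le_sum (f := fun i => x i * x i) (fun i _ => mul_self_nonneg _)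
        (Finset.mem_univ i)
    rw [hx.out] at h1
    exact abs_le_one_iff_mul_self_le_one.2 h1
  obtain ⟨x₀, hx₀, hmin⟩ := hK.exists_isMinOn
    ⟨Pi.single i₀ 1, by simp⟩ hcq.continuousOn
  replace hx₀ : x₀ ⬝ᵥ x₀ = 1 := hx₀
  set μ := x₀ ⬝ᵥ S *ᵥ x₀ with hμ
  have hray : ∀ x, μ * (x ⬝ᵥ x) ≤ x ⬝ᵥ S *ᵥ x := by
    intro x
    rcases eq_or_ne x 0 with rfl | hx
    · simp
    have hpos : 0 < x ⬝ᵥ x := by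
      have h0 : 0 ≤ x ⬝ᵥ x := Finset.sum_nonneg fun i _ => mul_self_nonneg _
      exact lt_of_le_of_ne h0 fun h => hx (dotProduct_self_eq_zero.1 h.symm)
    set r := Real.sqrt (x ⬝ᵥ x)
    have hr : 0 < r := Real.sqrt_pos.2 hpos
    have hr2 : r * r = x ⬝ᵥ x := Real.mul_self_sqrt hpos.le
    have hmem : (r⁻¹ • x) ⬝ᵥ (r⁻¹ • x) = 1 := by
      rw [smul_dotProduct, dotProduct_smul, ← hr2, smul_eq_mul, smul_eq_mul]
      field_simp
    have := hmin hmem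
    replace this : μ ≤ (r⁻¹ • x) ⬝ᵥ S *ᵥ (r⁻¹ • x) := this
    rw [mulVec_smul, smul_dotProduct, dotProduct_smul, smul_eq_mul, smul_eq_mul] at this
    rw [← hr2]
    calc μ * (r * r) ≤ (r⁻¹ * (r⁻¹ * (x ⬝ᵥ S *ᵥ x))) * (r * r) := by
          exact mul_le_mul_of_nonneg_right this (mul_self_nonneg r)
      _ = _ := by field_simp
  -- Absolute values do not increase the quadratic form, so `y` is again a minimizer.
  set y : ι → ℝ := fun i => |x₀ i| with hy
  have hyy : y ⬝ᵥ y = 1 := by rw [← hx₀]; simp [hy, dotProduct]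
  have hyS : y ⬝ᵥ S *ᵥ y ≤ μ := by
    rw [hμ]
    simp only [dotProduct, mulVec, Finset.mul_sum, hy]
    refine Finset.sum_le_sum fun i _ => Finset.sum_le_sum fun j _ => ?_
    by_cases hij : i = j
    · subst hij
      have := abs_mul_abs_self (x₀ i)
      rw [mul_left_comm, this, mul_left_comm]
    · have h1 := hS.nonpos i j hij
      have h2 := le_abs_self (x₀ i * x₀ j)
      rw [abs_mul] at h2
      nlinarith
  -- A positive semidefinite form vanishes only on its kernel, so the minimizer is an eigenvector.
  have hpsd : (S - μ • (1 : Matrix ι ι ℝ)).PosSemidef := by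
    refine PosSemidef.of_dotProduct_mulVec_nonneg ?_ fun x => ?_
    · ext i j
      simp [hS.symm j i, Matrix.one_apply, eq_comm]
    · have := hray x
      simp only [star_trivial, sub_mulVec, smul_mulVec, one_mulVec, dotProduct_sub,
        dotProduct_smul, smul_eq_mul]
      linarith
  have hyeig : S *ᵥ y = μ • y := by
    have h0 := (hpsd.dotProduct_mulVec_zero_iff y).1 (by
      refine le_antisymm ?_ (hpsd.dotProduct_mulVec_nonneg y)
      simp only [star_trivial, sub_mulVec, smul_mulVec, one_mulVec, dotProduct_sub,
        dotProduct_smul, smul_eq_mul, hyy]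
      linarith)
    simpa [sub_mulVec, smul_mulVec, sub_eq_zero] using h0
  refine ⟨y, μ, ?_, hyeig, hray⟩
  rcases hS.pos_or_eq_zero hH (x := y) (fun i => abs_nonneg _)
    (fun i hi => by rw [hyeig]; simp [hi]) with h | h
  · exact h
  · rw [h] at hyy; simp at hyy

/-- Pairing `S u` with the Perron vector `y` gives `μ (u ⬝ᵥ y) > 0`, so the least eigenvalue is
positive. -/
theorem exists_coercive (hH : H.Connected) (hS : IsZMatrixOn H S) {u : ι → ℝ}
    (hu : ∀ i, 0 < u i) (hSu : ∀ i, 0 ≤ (S *ᵥ u) i) (hne : S *ᵥ u ≠ 0) :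
    ∃ c > 0, ∀ x, c * (x ⬝ᵥ x) ≤ x ⬝ᵥ S *ᵥ x := by
  obtain ⟨y, μ, hy, hSy, hμ⟩ := hS.exists_perron hH
  refine ⟨μ, ?_, hμ⟩
  have h1 : y ⬝ᵥ S *ᵥ u = μ * (u ⬝ᵥ y) := by
    rw [hS.dotProduct_mulVec_comm, hSy, dotProduct_smul, smul_eq_mul]
  have h2 : 0 < y ⬝ᵥ S *ᵥ u := by
    obtain ⟨i, hi⟩ := Function.ne_iff.1 hne
    exact Finset.sum_pos' (fun j _ => mul_nonneg (hy j).le (hSu j))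
      ⟨i, Finset.mem_univ i, mul_pos (hy i) (lt_of_le_of_ne (hSu i) (Ne.symm hi))⟩
  have h3 : 0 ≤ u ⬝ᵥ y := Finset.sum_nonneg fun i _ => (mul_pos (hu i) (hy i)).le
  rw [h1] at h2
  exact pos_of_mul_pos_left h2 h3

/-- Testing `S x` against the negative part `q` of `x = p - q` gives `q ⬝ᵥ S q ≤ q ⬝ᵥ S p ≤ 0`, so
`q = 0` by coercivity. -/
theorem pos_of_mulVec_nonneg (hH : H.Connected) (hS : IsZMatrixOn H S) {c : ℝ} (hc : 0 < c)
    (hcoer : ∀ x, c * (x ⬝ᵥ x) ≤ x ⬝ᵥ S *ᵥ x) {x : ι → ℝ}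
    (hSx : ∀ i, 0 ≤ (S *ᵥ x) i) (hne : S *ᵥ x ≠ 0) : ∀ i, 0 < x i := by
  set q : ι → ℝ := fun i => max (-x i) 0 with hq
  set p : ι → ℝ := fun i => max (x i) 0 with hp
  have hpq : x = p - q := by
    ext i
    simp only [hp, hq, Pi.sub_apply]
    rcases le_total (x i) 0 with h | h
    · rw [max_eq_right h, max_eq_left (by linarith)]; ring
    · rw [max_eq_left h, max_eq_right (by linarith)]; ring
  have hq0 : ∀ i, 0 ≤ q i := fun i => le_max_right _ _
  have hp0 : ∀ i, 0 ≤ p i := fun i => le_max_right _ _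
  have hqp : ∀ i, q i * p i = 0 := fun i => by
    simp only [hp, hq]
    rcases le_total (x i) 0 with h | h
    · rw [max_eq_right h]; ring
    · rw [max_eq_right (by linarith : -x i ≤ 0)]; ring
  have h1 : 0 ≤ q ⬝ᵥ S *ᵥ x := Finset.sum_nonneg fun i _ => mul_nonneg (hq0 i) (hSx i)
  have h2 : q ⬝ᵥ S *ᵥ p ≤ 0 := by
    simp only [dotProduct, mulVec, Finset.mul_sum]
    refine Finset.sum_nonpos fun i _ => Finset.sum_nonpos fun j _ => ?_
    by_cases hij : i = j
    · subst hij
      have := hqp i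
      have h : q i * (S i i * p i) = S i i * (q i * p i) := by ring
      rw [h, this, mul_zero]
    · have := mul_nonneg (hq0 i) (hp0 j)
      nlinarith [hS.nonpos i j hij]
  have h3 : c * (q ⬝ᵥ q) ≤ 0 := by
    refine (hcoer q).trans ?_
    have : q ⬝ᵥ S *ᵥ x = q ⬝ᵥ S *ᵥ p - q ⬝ᵥ S *ᵥ q := by
      rw [← dotProduct_sub, ← mulVec_sub, ← hpq]
    linarith
  have h4 : q ⬝ᵥ q = 0 :=
    le_antisymm (by by_contra! h; nlinarith [mul_pos hc h])
      (Finset.sum_nonneg fun i _ => mul_self_nonneg _)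
  have h5 : q = 0 := dotProduct_self_eq_zero.1 h4
  have hx0 : ∀ i, 0 ≤ x i := fun i => by
    have := hp0 i
    rw [hpq, h5]; simpa using this
  rcases hS.pos_or_eq_zero hH hx0 (fun i _ => hSx i) with h | h
  · exact h
  · exact absurd (by rw [h, mulVec_zero]) hne

end IsZMatrixOn

/-! ### The power map and its symmetrized Jacobian -/

section PowerMap

variable {ι : Type*} [Fintype ι]

/-- The powers drawn at the voltages `V` in a network with admittance matrix `A` and
injected currents `b`. -/
def powerMap (A : Matrix ι ι ℝ) (b V : ι → ℝ) : ι → ℝ := fun i => V i * (b i - (A *ᵥ V) i)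

/-- The symmetrized negative Jacobian `[V] A [V] - [powerMap A b V]` of `powerMap`. -/
def symmJacobian [DecidableEq ι] (A : Matrix ι ι ℝ) (b V : ι → ℝ) : Matrix ι ι ℝ :=
  diagonal V * A * diagonal V - diagonal (powerMap A b V)

theorem powerMap_add (A : Matrix ι ι ℝ) (b V d : ι → ℝ) (i : ι) :
    powerMap A b (V + d) i = powerMap A b V i + d i * (b i - (A *ᵥ V) i) - V i * (A *ᵥ d) i
      - d i * (A *ᵥ d) i := by
  simp only [powerMap, mulVec_add, Pi.add_apply]; ring

theorem continuous_powerMap (A : Matrix ι ι ℝ) (b : ι → ℝ) : Continuous (powerMap A b) := by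
  unfold powerMap
  simp only [mulVec, dotProduct]
  fun_prop

theorem symmJacobian_mulVec [DecidableEq ι] (A : Matrix ι ι ℝ) (b V u : ι → ℝ) (i : ι) :
    (symmJacobian A b V *ᵥ u) i = V i * (A *ᵥ (V * u)) i - powerMap A b V i * u i := by
  have h : diagonal V *ᵥ u = V * u := by ext j; simp [mulVec, diagonal_dotProduct]
  rw [symmJacobian, sub_mulVec, Pi.sub_apply, Matrix.mul_assoc, ← mulVec_mulVec, ← mulVec_mulVec, h]
  simp [mulVec, diagonal_dotProduct]

theorem powerMap_add_smul [DecidableEq ι] (A : Matrix ι ι ℝ) (b V y : ι → ℝ) (ε : ℝ) (i : ι) :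
    powerMap A b (V + ε • (V * y)) i = powerMap A b V i - ε * (symmJacobian A b V *ᵥ y) i
      - ε ^ 2 * (V i * y i * (A *ᵥ (V * y)) i) := by
  rw [powerMap_add, symmJacobian_mulVec, mulVec_smul]
  simp only [Pi.smul_apply, Pi.mul_apply, smul_eq_mul, powerMap]
  ring

theorem continuous_symmJacobian_mulVec [DecidableEq ι] (A : Matrix ι ι ℝ) (b u : ι → ℝ) :
    Continuous fun V => symmJacobian A b V *ᵥ u := by
  have := continuous_powerMap A b
  refine continuous_pi fun i => ?_
  simp only [symmJacobian_mulVec]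
  simp only [mulVec, dotProduct, Pi.mul_apply]
  have : Continuous fun V => powerMap A b V i := (continuous_apply i).comp this
  fun_prop

end PowerMap

/-! ### Monotonicity, concavity and bounds for the powers -/

theorem add_le_sqrt_mul_sqrt {t u v u' v' : ℝ} (ht : 0 ≤ t) (ht1 : t ≤ 1) :
    (1 - t) * (u * u') + t * (v * v') ≤
      Real.sqrt ((1 - t) * u ^ 2 + t * v ^ 2) * Real.sqrt ((1 - t) * u' ^ 2 + t * v' ^ 2) := by
  have h1 : 0 ≤ 1 - t := by linarith
  rw [← Real.sqrt_mul (by positivity)]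
  refine (le_abs_self _).trans (Real.abs_le_sqrt ?_)
  nlinarith [mul_nonneg (mul_nonneg ht h1) (sq_nonneg (u * v' - v * u'))]

/-- The data of a connected resistive network: an admittance matrix supported on the graph
`H` and the injected currents. -/
structure IsLoadNetwork {ι : Type*} [Fintype ι] (H : SimpleGraph ι) (A : Matrix ι ι ℝ)
    (b : ι → ℝ) : Prop where
  connected : H.Connected
  zMatrix : IsZMatrixOn H A
  coercive : ∃ c > 0, ∀ x, c * (x ⬝ᵥ x) ≤ x ⬝ᵥ A *ᵥ x
  nonneg : ∀ i, 0 ≤ b i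
  ne_zero : b ≠ 0

namespace IsLoadNetwork

variable {ι : Type*} [Fintype ι] {H : SimpleGraph ι} {A : Matrix ι ι ℝ} {b : ι → ℝ}

theorem powerMap_le_of_le (hN : IsLoadNetwork H A b) {V W : ι → ℝ} (hVW : ∀ j, V j ≤ W j) {i : ι}
    (hi : V i = W i) (h0 : 0 ≤ V i) : powerMap A b V i ≤ powerMap A b W i := by
  rw [powerMap, powerMap, ← hi]
  refine mul_le_mul_of_nonneg_left (sub_le_sub_left ?_ _) h0
  refine Finset.sum_le_sum fun j _ => ?_
  by_cases hij : i = j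
  · subst hij; rw [hi]
  · exact mul_le_mul_of_nonpos_left (hVW j) (hN.zMatrix.nonpos i j hij)

theorem le_powerMap_sup (hN : IsLoadNetwork H A b) {V W P : ι → ℝ} (hV : ∀ i, 0 < V i)
    (hW : ∀ i, 0 < W i) (hPV : ∀ i, P i ≤ powerMap A b V i) (hPW : ∀ i, P i ≤ powerMap A b W i)
    (i : ι) : P i ≤ powerMap A b (V ⊔ W) i := by
  rcases le_total (W i) (V i) with h | h
  · exact (hPV i).trans (hN.powerMap_le_of_le (fun j => le_sup_left) (by simp [h]) (hV i).le)
  · exact (hPW i).trans (hN.powerMap_le_of_le (fun j => le_sup_right) (by simp [h]) (hW i).le)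

/-- As functions of the squared voltages, the diagonal terms are linear, while `b i * V i` and `-A i
j * V i * V j` are concave, by Cauchy–Schwarz. -/
theorem le_powerMap_sqrt (hN : IsLoadNetwork H A b) (U V : ι → ℝ) {t : ℝ}
    (ht : 0 ≤ t) (ht1 : t ≤ 1) (i : ι) :
    (1 - t) * powerMap A b U i + t * powerMap A b V i ≤
      powerMap A b (fun j => Real.sqrt ((1 - t) * U j ^ 2 + t * V j ^ 2)) i := by
  have h1 : 0 ≤ 1 - t := by linarith
  set W : ι → ℝ := fun j => Real.sqrt ((1 - t) * U j ^ 2 + t * V j ^ 2) with hW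
  have hexp : ∀ X : ι → ℝ, powerMap A b X i = b i * X i + ∑ j, -(A i j) * (X i * X j) := by
    intro X
    simp only [powerMap, mulVec, dotProduct, mul_sub, Finset.mul_sum]
    rw [sub_eq_add_neg, ← Finset.sum_neg_distrib, mul_comm]
    congr 1
    exact Finset.sum_congr rfl fun j _ => by ring
  have hlin : (1 - t) * U i + t * V i ≤ W i := by
    have := add_le_sqrt_mul_sqrt (u := U i) (v := V i) (u' := 1) (v' := 1) ht ht1
    simpa [hW] using this
  have hsum : (1 - t) * ∑ j, -(A i j) * (U i * U j) + t * ∑ j, -(A i j) * (V i * V j) ≤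
      ∑ j, -(A i j) * (W i * W j) := by
    rw [Finset.mul_sum, Finset.mul_sum, ← Finset.sum_add_distrib]
    refine Finset.sum_le_sum fun j _ => ?_
    by_cases hij : i = j
    · subst hij
      have : W i * W i = (1 - t) * U i ^ 2 + t * V i ^ 2 := Real.mul_self_sqrt (by positivity)
      rw [this]
      exact le_of_eq (by ring)
    · have h2 := add_le_sqrt_mul_sqrt (u := U i) (v := V i) (u' := U j) (v' := V j) ht ht1
      have h3 := hN.zMatrix.nonpos i j hij
      have := mul_le_mul_of_nonneg_left h2 (neg_nonneg.2 h3)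
      calc _ = -A i j * ((1 - t) * (U i * U j) + t * (V i * V j)) := by ring
        _ ≤ _ := this
  rw [hexp, hexp, hexp]
  have := mul_le_mul_of_nonneg_left hlin (hN.nonneg i)
  calc _ = b i * ((1 - t) * U i + t * V i) + ((1 - t) * ∑ j, -(A i j) * (U i * U j) +
        t * ∑ j, -(A i j) * (V i * V j)) := by ring
    _ ≤ _ := add_le_add this hsum

theorem exists_bound (hN : IsLoadNetwork H A b) (p : ℝ) :
    ∃ R, ∀ V, p ≤ ∑ i, powerMap A b V i → ‖V‖ ≤ R := by
  obtain ⟨c, hc, hcoer⟩ := hN.coercive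
  refine ⟨Real.sqrt ((b ⬝ᵥ b / c - 2 * p) / c), fun V hV => ?_⟩
  rw [pi_norm_le_iff_of_nonneg (Real.sqrt_nonneg _)]
  intro i
  refine Real.abs_le_sqrt ?_
  have h1 : ∑ i, powerMap A b V i = V ⬝ᵥ b - V ⬝ᵥ A *ᵥ V := by
    rw [← dotProduct_sub]; rfl
  have h2 : V i ^ 2 ≤ V ⬝ᵥ V := by
    rw [sq]
    exact Finset.single_le_sum (f := fun i => V i * V i) (fun i _ => mul_self_nonneg _)
        (Finset.mem_univ i)
  have h3 : V ⬝ᵥ b ≤ c / 2 * (V ⬝ᵥ V) + b ⬝ᵥ b / (2 * c) := by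
    simp only [dotProduct, Finset.mul_sum, Finset.sum_div]
    rw [← Finset.sum_add_distrib]
    refine Finset.sum_le_sum fun i _ => ?_
    have : c / 2 * (V i * V i) + b i * b i / (2 * c) - V i * b i = (c * V i - b i) ^ 2 / (2 * c) := by
      field_simp; ring
    have : 0 ≤ (c * V i - b i) ^ 2 / (2 * c) := by positivity
    linarith
  have h4 := hcoer V
  rw [le_div_iff₀ hc]
  have h5 : b ⬝ᵥ b / c = 2 * (b ⬝ᵥ b / (2 * c)) := by field_simp
  rw [h5]
  nlinarith

theorem dotProduct_self_pos (hN : IsLoadNetwork H A b) {y : ι → ℝ} (hy : ∀ i, 0 < y i) :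
    0 < y ⬝ᵥ y := by
  have := hN.connected.nonempty
  exact Finset.sum_pos (fun i _ => mul_pos (hy i) (hy i)) Finset.univ_nonempty

variable [DecidableEq ι]

theorem symmJacobian_isZMatrixOn (hN : IsLoadNetwork H A b) {V : ι → ℝ} (hV : ∀ i, 0 < V i) :
    IsZMatrixOn H (symmJacobian A b V) := by
  have happ : ∀ i j, i ≠ j → symmJacobian A b V i j = V i * A i j * V j := fun i j hij => by
    simp [symmJacobian, hij]
  refine ⟨fun i j => ?_, fun i j hij => ?_, fun i j hij => ?_⟩
  · by_cases hij : i = j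
    · rw [hij]
    · rw [happ i j hij, happ j i (Ne.symm hij), hN.zMatrix.symm i j]; ring
  · rw [happ i j hij]
    exact mul_nonpos_of_nonpos_of_nonneg
      (mul_nonpos_of_nonneg_of_nonpos (hV i).le (hN.zMatrix.nonpos i j hij)) (hV j).le
  · rw [happ i j hij.ne]
    exact mul_neg_of_neg_of_pos (mul_neg_of_pos_of_neg (hV i) (hN.zMatrix.neg i j hij)) (hV j)

/-- The weighted total power is strictly concave, if the weights form an eigenvector of the
symmetrized negative Jacobian for a nonnegative eigenvalue. -/
theorem exists_sum_powerMap_le (hN : IsLoadNetwork H A b) {V y : ι → ℝ} {μ : ℝ}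
    (hV : ∀ i, 0 < V i) (hy : ∀ i, 0 < y i) (hμ : 0 ≤ μ)
    (heig : symmJacobian A b V *ᵥ y = μ • y) :
    ∃ c > 0, ∀ W, ∑ i, y i * powerMap A b W i ≤ ∑ i, y i * powerMap A b V i
      - μ * ∑ i, y i / V i * (W i - V i) - c * ((W - V) ⬝ᵥ (W - V)) := by
  -- The left side is the gradient at `V` of the weighted total power.
  have heig' : ∀ i, y i * (b i - (A *ᵥ V) i) - (A *ᵥ (V * y)) i = - (μ * (y i / V i)) := by
    intro i
    have h := congrFun heig i
    rw [symmJacobian_mulVec, powerMap, Pi.smul_apply, smul_eq_mul] at h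
    have := (hV i).ne'
    field_simp
    linarith
  -- `-K` is the Hessian of the weighted total power; the positive vector `V`, with `K V ≥ 0` and `K
  -- V ≠ 0`, witnesses that `K` is coercive.
  set K := diagonal y * A + A * diagonal y with hK
  have hKapp : ∀ i j, K i j = (y i + y j) * A i j := fun i j => by
    simp [hK]; ring
  have hKZ : IsZMatrixOn H K := by
    refine ⟨fun i j => ?_, fun i j hij => ?_, fun i j hij => ?_⟩
    · rw [hKapp, hKapp, hN.zMatrix.symm i j]; ring
    · rw [hKapp]
      exact mul_nonpos_of_nonneg_of_nonpos (add_pos (hy i) (hy j)).le (hN.zMatrix.nonpos i j hij)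
    · rw [hKapp]
      exact mul_neg_of_pos_of_neg (add_pos (hy i) (hy j)) (hN.zMatrix.neg i j hij)
  have hKmul : ∀ x i, (K *ᵥ x) i = y i * (A *ᵥ x) i + (A *ᵥ (x * y)) i := fun x i => by
    have h : diagonal y *ᵥ x = x * y := by
      ext j; simp [mulVec, diagonal_dotProduct, mul_comm]
    rw [hK, add_mulVec, Pi.add_apply, ← mulVec_mulVec, ← mulVec_mulVec, h]
    simp [mulVec, diagonal_dotProduct]
  have hKV : ∀ i, (K *ᵥ V) i = y i * b i + μ * (y i / V i) := fun i => by
    rw [hKmul]; linarith [heig' i]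
  have hq : ∀ i, 0 ≤ μ * (y i / V i) := fun i => mul_nonneg hμ (div_pos (hy i) (hV i)).le
  obtain ⟨c, hc, hcoer⟩ := hKZ.exists_coercive hN.connected hV
    (fun i => by rw [hKV]; exact add_nonneg (mul_nonneg (hy i).le (hN.nonneg i)) (hq i))
    (fun h0 => hN.ne_zero (funext fun i => by
      have h1 := congrFun h0 i
      rw [hKV] at h1
      have h2 := mul_nonneg (hy i).le (hN.nonneg i)
      have h3 : y i * b i = 0 := by
        have := hq i
        simp only [Pi.zero_apply] at h1
        linarith
      exact (mul_eq_zero.1 h3).resolve_left (hy i).ne'))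
  refine ⟨c / 2, by positivity, fun W => ?_⟩
  set d := W - V with hd
  have hWV : W = V + d := by rw [hd]; abel
  have hquad : 2 * ∑ i, y i * d i * (A *ᵥ d) i = d ⬝ᵥ K *ᵥ d := by
    have e1 : d ⬝ᵥ K *ᵥ d = ∑ i, y i * d i * (A *ᵥ d) i + d ⬝ᵥ A *ᵥ (d * y) := by
      simp only [dotProduct, hKmul, mul_add, Finset.sum_add_distrib]
      congr 1
      exact Finset.sum_congr rfl fun i _ => by ring
    have e2 : d ⬝ᵥ A *ᵥ (d * y) = ∑ i, y i * d i * (A *ᵥ d) i := by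
      rw [hN.zMatrix.dotProduct_mulVec_comm]
      exact Finset.sum_congr rfl fun i _ => by simp only [Pi.mul_apply]; ring
    rw [e1, e2]; ring
  have hlin : ∑ i, y i * (V i * (A *ᵥ d) i) = ∑ i, d i * (A *ᵥ (V * y)) i := by
    have := hN.zMatrix.dotProduct_mulVec_comm (V * y) d
    calc _ = (V * y) ⬝ᵥ A *ᵥ d :=
          Finset.sum_congr rfl fun i _ => by simp only [Pi.mul_apply]; ring
      _ = _ := this
  have hmain : ∑ i, y i * powerMap A b W i = ∑ i, y i * powerMap A b V i
      - μ * ∑ i, y i / V i * (W i - V i) - ∑ i, y i * d i * (A *ᵥ d) i := by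
    have e : ∑ i, y i * powerMap A b W i = ∑ i, y i * powerMap A b V i
        + ∑ i, d i * (y i * (b i - (A *ᵥ V) i)) - ∑ i, y i * (V i * (A *ᵥ d) i)
        - ∑ i, y i * d i * (A *ᵥ d) i := by
      rw [← Finset.sum_add_distrib, ← Finset.sum_sub_distrib, ← Finset.sum_sub_distrib]
      refine Finset.sum_congr rfl fun i _ => ?_
      rw [hWV, powerMap_add]; ring
    have e3 : ∑ i, d i * (y i * (b i - (A *ᵥ V) i)) - ∑ i, d i * (A *ᵥ (V * y)) i
        = - (μ * ∑ i, y i / V i * (W i - V i)) := by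
      rw [← Finset.sum_sub_distrib, Finset.mul_sum, ← Finset.sum_neg_distrib]
      refine Finset.sum_congr rfl fun i _ => ?_
      rw [← mul_sub, heig' i, hd, Pi.sub_apply]; ring
    rw [e, hlin]; linarith
  rw [hmain]
  have := hcoer d
  linarith

end IsLoadNetwork

/-! ### Stable and semistable voltages -/

/-- The positive voltages at which the symmetrized negative Jacobian is positive semidefinite. -/
def semistableSet {ι : Type*} [Fintype ι] [DecidableEq ι] (A : Matrix ι ι ℝ) (b : ι → ℝ) :
    Set (ι → ℝ) :=
  {V | (∀ i, 0 < V i) ∧ ∀ x, 0 ≤ x ⬝ᵥ symmJacobian A b V *ᵥ x}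

/-- The positive voltages at which the symmetrized negative Jacobian is a nonsingular M-matrix. -/
def stableSet {ι : Type*} [Fintype ι] [DecidableEq ι] (A : Matrix ι ι ℝ) (b : ι → ℝ) :
    Set (ι → ℝ) :=
  {V | (∀ i, 0 < V i) ∧ ∃ u : ι → ℝ, (∀ i, 0 < u i) ∧ ∀ i, 0 < (symmJacobian A b V *ᵥ u) i}

namespace IsLoadNetwork

variable {ι : Type*} [Fintype ι] [DecidableEq ι] {H : SimpleGraph ι} {A : Matrix ι ι ℝ}
  {b : ι → ℝ}

theorem exists_eigenvector_of_mem_semistableSet (hN : IsLoadNetwork H A b) {V : ι → ℝ}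
    (hV : V ∈ semistableSet A b) :
    ∃ (y : ι → ℝ) (μ : ℝ), (∀ i, 0 < y i) ∧ 0 ≤ μ ∧ symmJacobian A b V *ᵥ y = μ • y ∧
      ∀ x, μ * (x ⬝ᵥ x) ≤ x ⬝ᵥ symmJacobian A b V *ᵥ x := by
  obtain ⟨y, μ, hy, heig, hμ⟩ := (hN.symmJacobian_isZMatrixOn hV.1).exists_perron hN.connected
  refine ⟨y, μ, hy, ?_, heig, hμ⟩
  have h := hV.2 y
  rw [heig, dotProduct_smul, smul_eq_mul] at h
  exact nonneg_of_mul_nonneg_left h (hN.dotProduct_self_pos hy)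

theorem coercive_of_mem_stableSet (hN : IsLoadNetwork H A b) {V : ι → ℝ}
    (hV : V ∈ stableSet A b) :
    ∃ c > 0, ∀ x, c * (x ⬝ᵥ x) ≤ x ⬝ᵥ symmJacobian A b V *ᵥ x := by
  obtain ⟨hV, u, hu, hSu⟩ := hV
  obtain ⟨i⟩ := hN.connected.nonempty
  exact (hN.symmJacobian_isZMatrixOn hV).exists_coercive hN.connected hu (fun i => (hSu i).le)
    fun h => (hSu i).ne' (congrFun h i)

theorem stableSet_subset (hN : IsLoadNetwork H A b) : stableSet A b ⊆ semistableSet A b := by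
  intro V hV
  obtain ⟨c, hc, hcoer⟩ := hN.coercive_of_mem_stableSet hV
  exact ⟨hV.1, fun x => (mul_nonneg hc.le
    (Finset.sum_nonneg fun i _ => mul_self_nonneg (x i))).trans (hcoer x)⟩

theorem mem_stableSet_or (hN : IsLoadNetwork H A b) {V : ι → ℝ} (hV : V ∈ semistableSet A b) :
    V ∈ stableSet A b ∨ ∃ y : ι → ℝ, (∀ i, 0 < y i) ∧ symmJacobian A b V *ᵥ y = 0 := by
  obtain ⟨y, μ, hy, hμ, heig, -⟩ := hN.exists_eigenvector_of_mem_semistableSet hV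
  rcases hμ.eq_or_lt with rfl | hμ
  · exact Or.inr ⟨y, hy, by rw [heig, zero_smul]⟩
  · exact Or.inl ⟨hV.1, y, hy, fun i => by rw [heig]; exact mul_pos hμ (hy i)⟩

theorem isOpen_stableSet (A : Matrix ι ι ℝ) (b : ι → ℝ) : IsOpen (stableSet A b) := by
  have h : stableSet A b = ⋃ u ∈ {u : ι → ℝ | ∀ i, 0 < u i},
      ((⋂ i, {V : ι → ℝ | 0 < V i}) ∩ ⋂ i, {V | 0 < (symmJacobian A b V *ᵥ u) i}) := by
    ext V
    simp only [stableSet, mem_iUnion, mem_inter_iff, mem_iInter]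
    constructor
    · rintro ⟨h1, u, hu, h2⟩
      exact ⟨u, hu, h1, h2⟩
    · rintro ⟨u, hu, h1, h2⟩
      exact ⟨h1, u, hu, h2⟩
  rw [h]
  refine isOpen_biUnion fun u _ => IsOpen.inter ?_ ?_
  · exact isOpen_iInter_of_finite fun i => isOpen_lt continuous_const (continuous_apply i)
  · exact isOpen_iInter_of_finite fun i => isOpen_lt continuous_const
      ((continuous_apply i).comp (continuous_symmJacobian_mulVec A b u))

/-- Diagonal entries of a positive semidefinite symmetrized negative Jacobian are nonnegative. -/
theorem le_of_mem_semistableSet {V : ι → ℝ} (hV : V ∈ semistableSet A b) (i : ι) :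
    b i ≤ A i i * V i + (A *ᵥ V) i := by
  have h := hV.2 (Pi.single i 1)
  rw [single_one_dotProduct, symmJacobian_mulVec, powerMap] at h
  have h2 : (A *ᵥ (V * Pi.single i 1)) i = A i i * V i := by
    have : V * Pi.single i 1 = V i • Pi.single i (1 : ℝ) := by
      ext j
      by_cases hj : j = i
      · subst hj; simp
      · simp [hj]
    rw [this, mulVec_smul]; simp [mul_comm]
  rw [h2, Pi.single_eq_same] at h
  nlinarith [hV.1 i]

theorem isClosed_semistableSet (hN : IsLoadNetwork H A b) : IsClosed (semistableSet A b) := by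
  -- Positivity is not a closed condition. The closed diagonal inequalities replace it: with them a
  -- vector `V ≥ 0` is positive or zero, and zero would force `b = 0`.
  have h : semistableSet A b = (⋂ i, {V : ι → ℝ | 0 ≤ V i}) ∩
      (⋂ i, {V : ι → ℝ | b i ≤ A i i * V i + (A *ᵥ V) i}) ∩
      ⋂ x : ι → ℝ, {V | 0 ≤ x ⬝ᵥ symmJacobian A b V *ᵥ x} := by
    ext V
    simp only [mem_inter_iff, mem_iInter]
    constructor
    · intro hV
      exact ⟨⟨fun i => (hV.1 i).le, fun i => le_of_mem_semistableSet hV i⟩, hV.2⟩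
    · rintro ⟨⟨h0, h1⟩, h2⟩
      refine ⟨?_, h2⟩
      rcases hN.zMatrix.pos_or_eq_zero hN.connected h0 (fun i hi => by
        have := (hN.nonneg i).trans (h1 i).out
        rwa [hi, mul_zero, zero_add] at this) with h | h
      · exact h
      · refine absurd (funext fun i => le_antisymm ?_ (hN.nonneg i)) hN.ne_zero
        have := (h1 i).out
        simpa [h] using this
  rw [h]
  refine ((isClosed_iInter fun i => ?_).inter (isClosed_iInter fun i => ?_)).inter
    (isClosed_iInter fun x => ?_)
  · exact isClosed_le continuous_const (continuous_apply i)
  · refine isClosed_le continuous_const ?_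
    simp only [mulVec, dotProduct]
    fun_prop
  · exact isClosed_le continuous_const
      (Continuous.dotProduct continuous_const (continuous_symmJacobian_mulVec A b x))

/-- Scaling gives `S(tV) = t² S(V) + t(t - 1) [V][b]`; the added diagonal is nonnegative and
nonzero, which rules out a positive kernel vector. -/
theorem smul_mem_stableSet (hN : IsLoadNetwork H A b) {V : ι → ℝ} (hV : V ∈ semistableSet A b)
    {t : ℝ} (ht : 1 < t) : t • V ∈ stableSet A b := by
  have ht0 : 0 < t := by linarith
  have hS : ∀ x i, (symmJacobian A b (t • V) *ᵥ x) i =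
      t ^ 2 * (symmJacobian A b V *ᵥ x) i + t * (t - 1) * (V i * b i * x i) := fun x i => by
    have : t • V * x = t • (V * x) := smul_mul_assoc _ _ _
    rw [symmJacobian_mulVec, symmJacobian_mulVec, powerMap, powerMap, this, mulVec_smul,
      mulVec_smul]
    simp only [Pi.smul_apply, smul_eq_mul]
    ring
  have hpos : ∀ i, 0 < (t • V) i := fun i => mul_pos ht0 (hV.1 i)
  have hdot : ∀ x, x ⬝ᵥ symmJacobian A b (t • V) *ᵥ x =
      t ^ 2 * (x ⬝ᵥ symmJacobian A b V *ᵥ x) + t * (t - 1) * ∑ i, V i * b i * (x i * x i) := by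
    intro x
    simp only [dotProduct, hS, mul_add, Finset.sum_add_distrib, Finset.mul_sum]
    congr 1 <;> exact Finset.sum_congr rfl fun i _ => by ring
  have hterm : ∀ (x : ι → ℝ) i, 0 ≤ V i * b i * (x i * x i) := fun x i =>
    mul_nonneg (mul_nonneg (hV.1 i).le (hN.nonneg i)) (mul_self_nonneg _)
  have hc : 0 < t * (t - 1) := mul_pos ht0 (by linarith)
  have hmem : t • V ∈ semistableSet A b := ⟨hpos, fun x => by
    rw [hdot]
    exact add_nonneg (mul_nonneg (sq_nonneg t) (hV.2 x))
      (mul_nonneg hc.le (Finset.sum_nonneg fun i _ => hterm x i))⟩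
  refine (hN.mem_stableSet_or hmem).resolve_right ?_
  rintro ⟨y, hy, h0⟩
  have h1 := hdot y
  rw [h0, dotProduct_zero] at h1
  have h2 : 0 < ∑ i, V i * b i * (y i * y i) := by
    obtain ⟨i, hi⟩ := Function.ne_iff.1 hN.ne_zero
    refine Finset.sum_pos' (fun j _ => hterm y j) ⟨i, Finset.mem_univ i, ?_⟩
    exact mul_pos (mul_pos (hV.1 i) (lt_of_le_of_ne (hN.nonneg i) (Ne.symm hi)))
      (mul_pos (hy i) (hy i))
  have h3 := mul_nonneg (sq_nonneg t) (hV.2 y)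
  have h4 := mul_pos hc h2
  linarith

theorem closure_stableSet (hN : IsLoadNetwork H A b) :
    closure (stableSet A b) = semistableSet A b := by
  refine Subset.antisymm (hN.isClosed_semistableSet.closure_subset_iff.2 hN.stableSet_subset) ?_
  intro V hV
  have hlim : Filter.Tendsto (fun t : ℝ => t • V) (nhdsWithin 1 (Ioi 1)) (nhds V) := by
    have : Continuous fun t : ℝ => t • V := by fun_prop
    simpa using (this.tendsto 1).mono_left nhdsWithin_le_nhds
  exact mem_closure_of_tendsto hlim
    (eventually_nhdsWithin_of_forall fun t ht => hN.smul_mem_stableSet hV ht)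

/-! ### Injectivity and singular semistable points -/

theorem eq_of_le_of_powerMap_le (hN : IsLoadNetwork H A b) {V W : ι → ℝ}
    (hV : V ∈ semistableSet A b) (hVW : V ≤ W)
    (hf : ∀ i, powerMap A b V i ≤ powerMap A b W i) : W = V := by
  obtain ⟨y, μ, hy, hμ, heig, -⟩ := hN.exists_eigenvector_of_mem_semistableSet hV
  obtain ⟨c, hc, h⟩ := hN.exists_sum_powerMap_le hV.1 hy hμ heig
  have h1 := h W
  have h2 : ∑ i, y i * powerMap A b V i ≤ ∑ i, y i * powerMap A b W i :=
    Finset.sum_le_sum fun i _ => mul_le_mul_of_nonneg_left (hf i) (hy i).le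
  have h3 : 0 ≤ μ * ∑ i, y i / V i * (W i - V i) :=
    mul_nonneg hμ (Finset.sum_nonneg fun i _ =>
      mul_nonneg (div_pos (hy i) (hV.1 i)).le (sub_nonneg.2 (hVW i)))
  have h4 : 0 ≤ (W - V) ⬝ᵥ (W - V) := Finset.sum_nonneg fun i _ => mul_self_nonneg _
  have h5 : (W - V) ⬝ᵥ (W - V) = 0 := by nlinarith
  exact sub_eq_zero.1 (dotProduct_self_eq_zero.1 h5)

theorem injOn_powerMap (hN : IsLoadNetwork H A b) : InjOn (powerMap A b) (semistableSet A b) := by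
  intro V hV W hW hVW
  have h : ∀ i, powerMap A b V i ≤ powerMap A b (V ⊔ W) i :=
    hN.le_powerMap_sup hV.1 hW.1 (fun i => le_rfl) (fun i => (congrFun hVW i).le)
  have h1 := hN.eq_of_le_of_powerMap_le hV le_sup_left h
  have h2 := hN.eq_of_le_of_powerMap_le hW le_sup_right
    fun i => (congrFun hVW i).ge.trans (h i)
  exact h1.symm.trans h2

/-- At a singular point of the semistable set, a positive combination of the powers is
uniquely maximal. -/
theorem exists_sum_powerMap_lt (hN : IsLoadNetwork H A b) {V y : ι → ℝ} (hV : ∀ i, 0 < V i)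
    (hy : ∀ i, 0 < y i) (h0 : symmJacobian A b V *ᵥ y = 0) (W : ι → ℝ) (hW : W ≠ V) :
    ∑ i, y i * powerMap A b W i < ∑ i, y i * powerMap A b V i := by
  obtain ⟨c, hc, h⟩ := hN.exists_sum_powerMap_le hV hy le_rfl (by rw [h0, zero_smul])
  have h1 := h W
  have h4 : 0 ≤ (W - V) ⬝ᵥ (W - V) := Finset.sum_nonneg fun i _ => mul_self_nonneg _
  have h5 : (W - V) ⬝ᵥ (W - V) ≠ 0 := fun h =>
    hW (sub_eq_zero.1 (dotProduct_self_eq_zero.1 h))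
  have := mul_pos hc (lt_of_le_of_ne h4 h5.symm)
  linarith

theorem mem_stableSet_of_forall_lt (hN : IsLoadNetwork H A b) {V W : ι → ℝ}
    (hV : V ∈ semistableSet A b) (hW : ∀ i, powerMap A b V i < powerMap A b W i) :
    V ∈ stableSet A b := by
  refine (hN.mem_stableSet_or hV).resolve_right ?_
  rintro ⟨y, hy, h0⟩
  obtain ⟨i⟩ := hN.connected.nonempty
  have hne : W ≠ V := by
    rintro rfl
    exact lt_irrefl _ (hW i)
  have h1 := hN.exists_sum_powerMap_lt hV.1 hy h0 W hne
  have h2 : ∑ i, y i * powerMap A b V i ≤ ∑ i, y i * powerMap A b W i :=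
    Finset.sum_le_sum fun i _ => mul_le_mul_of_nonneg_left (hW i).le (hy i).le
  linarith

theorem symmJacobian_mulVec_of_mulVec_eq {U : ι → ℝ} (hU : A *ᵥ U = b) (x : ι → ℝ) :
    symmJacobian A b U *ᵥ x = U * A *ᵥ (U * x) := by
  ext i
  rw [symmJacobian_mulVec, powerMap, hU]
  simp

theorem mem_stableSet_of_mulVec_eq (hN : IsLoadNetwork H A b) {U : ι → ℝ} (hU : A *ᵥ U = b)
    (hpos : ∀ i, 0 < U i) : U ∈ stableSet A b := by
  obtain ⟨c, hc, hcoer⟩ := hN.coercive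
  have hdot : ∀ x, x ⬝ᵥ symmJacobian A b U *ᵥ x = (U * x) ⬝ᵥ A *ᵥ (U * x) := fun x => by
    rw [symmJacobian_mulVec_of_mulVec_eq hU]
    exact Finset.sum_congr rfl fun i _ => by simp only [Pi.mul_apply]; ring
  have hmem : U ∈ semistableSet A b := ⟨hpos, fun x => by
    rw [hdot]
    exact (mul_nonneg hc.le (Finset.sum_nonneg fun i _ => mul_self_nonneg _)).trans (hcoer _)⟩
  refine (hN.mem_stableSet_or hmem).resolve_right ?_
  rintro ⟨y, hy, h0⟩
  have h1 := hcoer (U * y)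
  rw [← hdot, h0, dotProduct_zero] at h1
  have h2 := mul_pos hc (hN.dotProduct_self_pos (y := U * y) fun i => mul_pos (hpos i) (hy i))
  linarith

/-- If `S(X) y = 0` with `y > 0`, then `X` uniquely maximizes the `y`-weighted power, with value `t
s` for `s = y ⬝ᵥ P`. Comparison with `U` gives `0 < t s` and with a preimage of `P` gives `s ≤ t s`,
contradicting `t < 1`. -/
theorem mem_stableSet_of_powerMap_eq_smul (hN : IsLoadNetwork H A b) {U X P : ι → ℝ}
    (hU : A *ᵥ U = b) (hpos : ∀ i, 0 < U i) (hP : ∃ W, powerMap A b W = P) {t : ℝ} (ht : t < 1)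
    (ht0 : 0 ≤ t) (hX : X ∈ semistableSet A b) (hfX : powerMap A b X = t • P) :
    X ∈ stableSet A b := by
  have hUs := hN.mem_stableSet_of_mulVec_eq hU hpos
  refine (hN.mem_stableSet_or hX).resolve_right ?_
  rintro ⟨y, hy, h0⟩
  obtain ⟨W, rfl⟩ := hP
  have hUX : U ≠ X := by
    rintro rfl
    obtain ⟨c, hc, hcoer⟩ := hN.coercive_of_mem_stableSet hUs
    have h1 := hcoer y
    rw [h0, dotProduct_zero] at h1
    have := mul_pos hc (hN.dotProduct_self_pos hy)
    linarith
  have hXs : ∑ i, y i * powerMap A b X i = t * ∑ i, y i * powerMap A b W i := by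
    rw [hfX, Finset.mul_sum]
    exact Finset.sum_congr rfl fun i _ => by simp only [Pi.smul_apply, smul_eq_mul]; ring
  have h1 := hN.exists_sum_powerMap_lt hX.1 hy h0 U hUX
  have h2 : ∑ i, y i * powerMap A b U i = 0 :=
    Finset.sum_eq_zero fun i _ => by simp [powerMap, hU]
  have h3 : ∑ i, y i * powerMap A b W i ≤ ∑ i, y i * powerMap A b X i := by
    rcases eq_or_ne W X with h | h
    · rw [h]
    · exact (hN.exists_sum_powerMap_lt hX.1 hy h0 W h).le
  rw [h2, hXs] at h1
  rw [hXs] at h3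
  nlinarith

/-! ### Existence of semistable voltages -/

theorem exists_mem_semistableSet (hN : IsLoadNetwork H A b) {V P : ι → ℝ} (hV : ∀ i, 0 < V i)
    (hP : ∀ i, P i ≤ powerMap A b V i) : ∃ X ∈ semistableSet A b, powerMap A b X = P := by
  have hcf : ∀ i, Continuous fun V => powerMap A b V i := fun i =>
    (continuous_apply i).comp (continuous_powerMap A b)
  set T : Set (ι → ℝ) := {W | V ≤ W ∧ ∀ i, P i ≤ powerMap A b W i} with hT
  have hTc : IsCompact T := by
    refine Metric.isCompact_of_isClosed_isBounded ?_ ?_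
    · have : T = Ici V ∩ ⋂ i, {W | P i ≤ powerMap A b W i} := by
        ext W; simp only [mem_inter_iff, mem_iInter]; rfl
      rw [this]
      exact isClosed_Ici.inter (isClosed_iInter fun i => isClosed_le continuous_const (hcf i))
    · obtain ⟨R, hR⟩ := hN.exists_bound (∑ i, P i)
      refine (Metric.isBounded_closedBall (x := (0 : ι → ℝ)) (r := R)).subset fun W hW => ?_
      rw [mem_closedBall_zero_iff]
      exact hR W (Finset.sum_le_sum fun i _ => hW.2 i)
  obtain ⟨X, hX, hmax⟩ := hTc.exists_isMaxOn (f := fun W => ∑ i, W i) ⟨V, le_rfl, hP⟩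
    (by fun_prop)
  have hXpos : ∀ i, 0 < X i := fun i => (hV i).trans_le (hX.1 i)
  have hmax' : ∀ W, X ≤ W → (∀ i, P i ≤ powerMap A b W i) → W = X := by
    intro W hXW hW
    have h1 : ∑ i, W i ≤ ∑ i, X i := hmax (show W ∈ T from ⟨hX.1.trans hXW, hW⟩)
    have h2 : ∑ i, W i = ∑ i, X i := le_antisymm h1 (Finset.sum_le_sum fun i _ => hXW i)
    exact funext fun i =>
      ((Finset.sum_eq_sum_iff_of_le fun i _ => hXW i).1 h2.symm i (Finset.mem_univ i)).symm
  refine ⟨X, ⟨hXpos, ?_⟩, funext fun i => le_antisymm ?_ (hX.2 i)⟩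
  · obtain ⟨y, μ, hy, heig, hμ⟩ := (hN.symmJacobian_isZMatrixOn hXpos).exists_perron hN.connected
    suffices 0 ≤ μ from fun x => (mul_nonneg this
      (Finset.sum_nonneg fun i _ => mul_self_nonneg (x i))).trans (hμ x)
    by_contra! hneg
    -- With a negative eigenvalue, a small step along `X * y` raises every voltage and, to first
    -- order, every power, against maximality.
    have hev : ∀ᶠ ε : ℝ in nhdsWithin 0 (Ioi 0),
        ∀ i, P i ≤ powerMap A b (X + ε • (X * y)) i := by
      refine Filter.eventually_all.2 fun i => ?_
      have hlim : Filter.Tendsto (fun ε : ℝ => ε * (X i * y i * (A *ᵥ (X * y)) i))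
          (nhdsWithin 0 (Ioi 0)) (nhds 0) := by
        have : Continuous fun ε : ℝ => ε * (X i * y i * (A *ᵥ (X * y)) i) := by fun_prop
        simpa using (this.tendsto 0).mono_left nhdsWithin_le_nhds
      filter_upwards [hlim.eventually_lt_const (neg_pos.2 (mul_neg_of_neg_of_pos hneg (hy i))),
        self_mem_nhdsWithin] with ε h1 hε
      have hε' : (0 : ℝ) < ε := hε
      rw [powerMap_add_smul, heig, Pi.smul_apply, smul_eq_mul]
      have := hX.2 i
      nlinarith
    obtain ⟨ε, hε, hε0⟩ := (hev.and self_mem_nhdsWithin).exists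
    have hε0' : (0 : ℝ) < ε := hε0
    have hinc : ∀ i, 0 < ε * (X i * y i) := fun i => mul_pos hε0' (mul_pos (hXpos i) (hy i))
    have h1 := hmax' _ (fun i => by
      have := hinc i
      simp only [Pi.add_apply, Pi.smul_apply, Pi.mul_apply, smul_eq_mul]
      linarith) hε
    obtain ⟨i⟩ := hN.connected.nonempty
    have h2 := congrFun h1 i
    have := hinc i
    simp only [Pi.add_apply, Pi.smul_apply, Pi.mul_apply, smul_eq_mul] at h2
    linarith
  -- If node `i` has slack, raising its voltage alone slightly keeps the constraint there and does
  -- not lower the powers elsewhere.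
  · by_contra! hlt
    have hlim : Filter.Tendsto (fun ε : ℝ => powerMap A b (X + ε • Pi.single i 1) i)
        (nhdsWithin 0 (Ioi 0)) (nhds (powerMap A b X i)) := by
      have : Continuous fun ε : ℝ => powerMap A b (X + ε • Pi.single i 1) i :=
        (hcf i).comp (by fun_prop)
      simpa using (this.tendsto 0).mono_left nhdsWithin_le_nhds
    obtain ⟨ε, hε, hε0⟩ := ((hlim.eventually_const_lt hlt).and self_mem_nhdsWithin).exists
    have hε0' : (0 : ℝ) < ε := hε0
    have hle : X ≤ X + ε • Pi.single i (1 : ℝ) := by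
      refine le_add_of_nonneg_right (smul_nonneg hε0'.le ?_)
      exact Pi.single_nonneg.2 zero_le_one
    have h1 := hmax' _ hle fun j => by
      by_cases hj : j = i
      · rw [hj]; exact hε.le
      · exact (hX.2 j).trans (hN.powerMap_le_of_le hle (by simp [hj]) (hXpos j).le)
    have h2 := congrFun h1 i
    simp only [Pi.add_apply, Pi.smul_apply, Pi.single_eq_same, smul_eq_mul] at h2
    linarith

theorem exists_powerMap_eq_smul (hN : IsLoadNetwork H A b) {U P : ι → ℝ}
    (hU : A *ᵥ U = b) (hpos : ∀ i, 0 < U i) (hP : ∃ W : ι → ℝ, (∀ i, 0 < W i) ∧ powerMap A b W = P)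
    {t : ℝ} (ht : t ∈ Icc (0 : ℝ) 1) : ∃ X ∈ semistableSet A b, powerMap A b X = t • P := by
  obtain ⟨W, hW, rfl⟩ := hP
  refine hN.exists_mem_semistableSet
    (V := fun j => Real.sqrt ((1 - t) * U j ^ 2 + t * W j ^ 2)) (fun i => ?_) fun i => ?_
  · refine Real.sqrt_pos.2 ?_
    have h1 : 0 < U i ^ 2 := pow_pos (hpos i) 2
    have h2 : 0 < W i ^ 2 := pow_pos (hW i) 2
    rcases ht.1.eq_or_lt with rfl | h
    · simpa using h1
    · exact add_pos_of_nonneg_of_pos (mul_nonneg (by linarith [ht.2]) h1.le) (mul_pos h h2)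
  · have h := hN.le_powerMap_sqrt U W ht.1 ht.2 i
    have h0 : powerMap A b U i = 0 := by simp [powerMap, hU]
    rw [h0, mul_zero, zero_add] at h
    exact h

end IsLoadNetwork

/-! ### From grids to load networks -/

namespace DCGrid

variable {n m : ℕ} (G : DCGrid n m)

theorem YLL_apply_of_ne {i j : Fin n} (hij : i ≠ j) [Decidable (G.graph.Adj (.inl i) (.inl j))] :
    G.YLL i j = if G.graph.Adj (.inl i) (.inl j) then -G.w (.inl i) (.inl j) else 0 := by
  simp [YLL, Y, toBlocks₁₁, hij]

theorem YLS_apply (i : Fin n) (k : Fin m) [Decidable (G.graph.Adj (.inl i) (.inr k))] :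
    G.YLS i k = if G.graph.Adj (.inl i) (.inr k) then -G.w (.inl i) (.inr k) else 0 := by
  simp [YLS, Y, toBlocks₁₂]

theorem YLS_nonpos (i : Fin n) (k : Fin m) : G.YLS i k ≤ 0 := by
  classical
  rw [YLS_apply]
  split_ifs with h
  · exact neg_nonpos.2 (G.w_pos _ _ h).le
  · exact le_rfl

theorem exists_YLS_neg : ∃ i k, G.YLS i k < 0 := by
  classical
  by_contra! hc
  obtain ⟨i₀⟩ := G.loads_connected.nonempty
  have h := G.connected.forall_of_adj (p := fun x => x.isLeft = true) (i := .inl i₀)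
    (fun x y hxy hx => ?_) rfl (.inr ⟨0, G.sources_nonempty⟩)
  · simp at h
  · rcases x with i | k
    · rcases y with j | k
      · rfl
      · have := hc i k
        rw [YLS_apply, if_pos hxy] at this
        have := G.w_pos _ _ hxy
        linarith
    · simp at hx

theorem YLL_isZMatrixOn :
    IsZMatrixOn (G.graph.comap (Sum.inl : Fin n → Fin n ⊕ Fin m)) G.YLL := by
  classical
  refine ⟨fun i j => ?_, fun i j hij => ?_, fun i j hij => ?_⟩
  · by_cases hij : i = j
    · rw [hij]
    · rw [G.YLL_apply_of_ne hij, G.YLL_apply_of_ne (Ne.symm hij), G.w_symm,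
        if_congr (G.graph.adj_comm _ _) rfl rfl]
  · rw [G.YLL_apply_of_ne hij]
    split_ifs with h
    · exact neg_nonpos.2 (G.w_pos _ _ h).le
    · exact le_rfl
  · have h : G.graph.Adj (.inl i) (.inl j) := hij
    rw [G.YLL_apply_of_ne hij.ne, if_pos h]
    exact neg_neg_of_pos (G.w_pos _ _ h)

theorem Y_mulVec_one : G.Y *ᵥ 1 = 0 := by
  classical
  ext i
  have h : ∀ j, G.Y i j = (if i = j then ∑ k with G.graph.Adj k i, G.w i k else 0)
      - if G.graph.Adj j i then G.w i j else 0 := fun j => by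
    by_cases hij : i = j
    · subst hij
      simp only [Y, of_apply, if_true, SimpleGraph.irrefl, if_false, sub_zero]
    · simp [Y, hij, G.graph.adj_comm j i]
      split_ifs <;> simp
  simp [mulVec, dotProduct, h, Finset.sum_filter]

theorem YLL_mulVec_one : G.YLL *ᵥ 1 = -(G.YLS *ᵥ 1) := by
  ext i
  have h := congrFun G.Y_mulVec_one (.inl i)
  simp only [mulVec, dotProduct, Fintype.sum_sum_type, Pi.one_apply, Pi.zero_apply] at h
  simp only [mulVec, dotProduct, YLL, YLS, toBlocks₁₁, toBlocks₁₂, of_apply, Pi.one_apply,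
    Pi.neg_apply]
  linarith

theorem neg_YLS_mulVec_nonneg {v : Fin m → ℝ} (hv : ∀ k, 0 < v k) (i : Fin n) :
    0 ≤ (-(G.YLS *ᵥ v)) i := by
  simp only [mulVec, dotProduct, Pi.neg_apply, ← Finset.sum_neg_distrib]
  exact Finset.sum_nonneg fun k _ => by nlinarith [G.YLS_nonpos i k, hv k]

theorem neg_YLS_mulVec_ne_zero {v : Fin m → ℝ} (hv : ∀ k, 0 < v k) : -(G.YLS *ᵥ v) ≠ 0 := by
  obtain ⟨i, k, hik⟩ := G.exists_YLS_neg
  intro h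
  have h1 : 0 < (-(G.YLS *ᵥ v)) i := by
    simp only [mulVec, dotProduct, Pi.neg_apply, ← Finset.sum_neg_distrib]
    exact Finset.sum_pos' (fun k _ => by nlinarith [G.YLS_nonpos i k, hv k])
      ⟨k, Finset.mem_univ k, by nlinarith [hv k]⟩
  rw [h] at h1
  exact lt_irrefl _ h1

/-- Rows of `Y` sum to zero, so `Y_LL 1 = -Y_LS 1`, which is nonnegative, and nonzero because some
line joins a load to a source. -/
theorem YLL_coercive : ∃ c > 0, ∀ x, c * (x ⬝ᵥ x) ≤ x ⬝ᵥ G.YLL *ᵥ x := by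
  have h1 : ∀ k : Fin m, 0 < (1 : Fin m → ℝ) k := fun _ => zero_lt_one
  exact G.YLL_isZMatrixOn.exists_coercive G.loads_connected (u := 1) (fun _ => zero_lt_one)
    (fun i => by rw [YLL_mulVec_one]; exact G.neg_YLS_mulVec_nonneg h1 i)
    (by rw [YLL_mulVec_one]; exact G.neg_YLS_mulVec_ne_zero h1)

end DCGrid

theorem Matrix.isUnit_det_of_coercive {ι : Type*} [Fintype ι] [DecidableEq ι]
    {S : Matrix ι ι ℝ} (h : ∃ c > 0, ∀ x, c * (x ⬝ᵥ x) ≤ x ⬝ᵥ S *ᵥ x) : IsUnit S.det := by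
  obtain ⟨c, hc, hcoer⟩ := h
  rw [← isUnit_iff_isUnit_det, ← mulVec_injective_iff_isUnit, ← coe_mulVecLin,
    ← LinearMap.ker_eq_bot, LinearMap.ker_eq_bot']
  intro x hx
  have h1 := hcoer x
  rw [show S *ᵥ x = 0 from hx, dotProduct_zero] at h1
  refine dotProduct_self_eq_zero.1 (le_antisymm ?_ (Finset.sum_nonneg fun i _ => mul_self_nonneg _))
  by_contra! h2
  linarith [mul_pos hc h2]

namespace DCGrid

variable {n m : ℕ} (G : DCGrid n m)

theorem YLL_mulVec_Vopen : G.YLL *ᵥ G.Vopen = -(G.YLS *ᵥ G.VS) := by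
  rw [Vopen, mulVec_neg, mulVec_mulVec, mul_nonsing_inv _ (isUnit_det_of_coercive G.YLL_coercive),
    one_mulVec]

theorem isLoadNetwork :
    IsLoadNetwork (G.graph.comap (Sum.inl : Fin n → Fin n ⊕ Fin m)) G.YLL (G.YLL *ᵥ G.Vopen) where
  connected := G.loads_connected
  zMatrix := G.YLL_isZMatrixOn
  coercive := G.YLL_coercive
  nonneg := by rw [YLL_mulVec_Vopen]; exact G.neg_YLS_mulVec_nonneg G.VS_pos
  ne_zero := by rw [YLL_mulVec_Vopen]; exact G.neg_YLS_mulVec_ne_zero G.VS_pos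

theorem Vopen_pos : ∀ i, 0 < G.Vopen i := by
  obtain ⟨c, hc, hcoer⟩ := G.YLL_coercive
  exact G.YLL_isZMatrixOn.pos_of_mulVec_nonneg G.loads_connected hc hcoer G.isLoadNetwork.nonneg
    G.isLoadNetwork.ne_zero

theorem Pc_eq_powerMap : G.Pc = powerMap G.YLL (G.YLL *ᵥ G.Vopen) := by
  ext V i
  simp [Pc, powerMap, mulVec_sub, mulVec, diagonal_dotProduct, mul_sub]

theorem isOperatingPoint_iff {V P : Fin n → ℝ} :
    G.IsOperatingPoint V P ↔ (∀ i, 0 < V i) ∧ G.Pc V = P := by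
  refine and_congr_right fun _ => ?_
  have : G.Pc V = -(diagonal V *ᵥ (G.YLL *ᵥ (V - G.Vopen))) := by
    rw [Pc, ← mulVec_neg, ← mulVec_neg, neg_sub]
  rw [this, neg_eq_iff_add_eq_zero]

theorem mem_F_iff {P : Fin n → ℝ} : P ∈ G.F ↔ ∃ V, (∀ i, 0 < V i) ∧ G.Pc V = P := by
  simp only [F, mem_ofPred_eq, isOperatingPoint_iff]

/-! ### The Jacobian and long-term voltage stability -/

theorem hasStrictFDerivAt_Pc (V : Fin n → ℝ) :
    HasStrictFDerivAt G.Pc (LinearMap.toContinuousLinearMap (Matrix.toLin'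
      (diagonal (G.YLL *ᵥ (G.Vopen - V)) - diagonal V * G.YLL))) V := by
  rw [Pc_eq_powerMap, hasStrictFDerivAt_pi']
  intro i
  have h1 : HasStrictFDerivAt (fun W : Fin n → ℝ => W i)
      (ContinuousLinearMap.proj (R := ℝ) (φ := fun _ : Fin n => ℝ) i) V :=
    hasStrictFDerivAt_apply i V
  have h2 : HasStrictFDerivAt (fun W : Fin n → ℝ => (G.YLL *ᵥ G.Vopen) i - (G.YLL *ᵥ W) i)
      (-((ContinuousLinearMap.proj (R := ℝ) (φ := fun _ : Fin n => ℝ) i).comp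
        (LinearMap.toContinuousLinearMap (Matrix.toLin' G.YLL)))) V :=
    ((ContinuousLinearMap.proj (R := ℝ) (φ := fun _ : Fin n => ℝ) i).comp
        (LinearMap.toContinuousLinearMap (Matrix.toLin' G.YLL))).hasStrictFDerivAt.const_sub _
  refine (h1.mul h2).congr_fderiv ?_
  refine ContinuousLinearMap.ext fun u => ?_
  simp [-mulVec_mulVec, mulVec_sub, mulVec, diagonal_dotProduct]
  ring

theorem jacobian_eq (V : Fin n → ℝ) :
    G.jacobian V = diagonal (G.YLL *ᵥ (G.Vopen - V)) - diagonal V * G.YLL := by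
  rw [jacobian, (G.hasStrictFDerivAt_Pc V).hasFDerivAt.fderiv,
    LinearMap.coe_toContinuousLinearMap, LinearMap.toMatrix'_toLin']

theorem hasStrictFDerivAt_Pc_jacobian (V : Fin n → ℝ) :
    HasStrictFDerivAt G.Pc
      (LinearMap.toContinuousLinearMap (Matrix.toLin' (G.jacobian V))) V := by
  rw [jacobian_eq]; exact G.hasStrictFDerivAt_Pc V

theorem symmJacobian_mulVec_eq (V u : Fin n → ℝ) :
    symmJacobian G.YLL (G.YLL *ᵥ G.Vopen) V *ᵥ u = -(G.jacobian V *ᵥ (V * u)) := by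
  ext i
  rw [symmJacobian_mulVec, jacobian_eq]
  simp [powerMap, sub_mulVec, ← mulVec_mulVec, mulVec_sub, mulVec, diagonal_dotProduct]
  ring

theorem isUnit_det_jacobian {V : Fin n → ℝ}
    (hV : V ∈ stableSet G.YLL (G.YLL *ᵥ G.Vopen)) : IsUnit (G.jacobian V).det := by
  obtain ⟨c, hc, hcoer⟩ := G.isLoadNetwork.coercive_of_mem_stableSet hV
  rw [← isUnit_iff_isUnit_det, ← mulVec_injective_iff_isUnit, ← coe_mulVecLin,
    ← LinearMap.ker_eq_bot, LinearMap.ker_eq_bot']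
  intro x hx
  have hVx : V * (x / V) = x := by
    ext i; simp [mul_div_cancel₀ _ (hV.1 i).ne']
  have h0 : symmJacobian G.YLL (G.YLL *ᵥ G.Vopen) V *ᵥ (x / V) = 0 := by
    rw [symmJacobian_mulVec_eq, hVx]
    simpa using hx
  have h1 := mulVec_injective_iff_isUnit.2
    ((isUnit_iff_isUnit_det _).2 (isUnit_det_of_coercive ⟨c, hc, hcoer⟩))
    (h0.trans (mulVec_zero _).symm)
  rw [← hVx, h1, mul_zero]

theorem mem_stableSet_of_isUnit_det {V : Fin n → ℝ}
    (hV : V ∈ semistableSet G.YLL (G.YLL *ᵥ G.Vopen)) (hJ : IsUnit (G.jacobian V).det) :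
    V ∈ stableSet G.YLL (G.YLL *ᵥ G.Vopen) := by
  refine (G.isLoadNetwork.mem_stableSet_or hV).resolve_right ?_
  rintro ⟨y, hy, h0⟩
  rw [symmJacobian_mulVec_eq, neg_eq_zero] at h0
  have h1 := mulVec_injective_iff_isUnit.2 ((isUnit_iff_isUnit_det _).2 hJ)
    (h0.trans (mulVec_zero _).symm)
  obtain ⟨i⟩ := G.loads_connected.nonempty
  exact (mul_pos (hV.1 i) (hy i)).ne' (congrFun h1 i)

/-- Since `S(V) = -J [V]`, a negative `J⁻¹` makes `u = -(J⁻¹ 1) / V` positive with `S(V) u = 1`.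
Conversely, each column of `-J⁻¹` divided by `V` solves `S(V) x = e_j`, hence is positive. -/
theorem D_eq_stableSet : G.D = stableSet G.YLL (G.YLL *ᵥ G.Vopen) := by
  ext V
  constructor
  · rintro ⟨P, hop, hJ, hneg⟩
    refine ⟨hop.1, (-((G.jacobian V)⁻¹ *ᵥ 1)) / V, fun i => div_pos ?_ (hop.1 i), fun i => ?_⟩
    · have := G.loads_connected.nonempty
      simp only [mulVec, dotProduct, Pi.neg_apply, Pi.one_apply, mul_one]
      exact neg_pos.2 (Finset.sum_neg (fun j _ => hneg i j) Finset.univ_nonempty)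
    · have h : V * (-((G.jacobian V)⁻¹ *ᵥ 1) / V) = -((G.jacobian V)⁻¹ *ᵥ 1) := by
        ext j
        simp only [Pi.mul_apply, Pi.div_apply]
        exact mul_div_cancel₀ _ (hop.1 j).ne'
      rw [symmJacobian_mulVec_eq, h, mulVec_neg, mulVec_mulVec, mul_nonsing_inv _ hJ, one_mulVec,
        neg_neg]
      exact zero_lt_one
  · intro hV
    have hJ := G.isUnit_det_jacobian hV
    refine ⟨G.Pc V, G.isOperatingPoint_iff.2 ⟨hV.1, rfl⟩, hJ, fun i j => ?_⟩
    obtain ⟨c, hc, hcoer⟩ := G.isLoadNetwork.coercive_of_mem_stableSet hV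
    set v := (G.jacobian V)⁻¹ *ᵥ Pi.single j 1 with hv
    have h : V * (-v / V) = -v := by
      ext j
      simp only [Pi.mul_apply, Pi.div_apply]
      exact mul_div_cancel₀ _ (hV.1 j).ne'
    have hS : symmJacobian G.YLL (G.YLL *ᵥ G.Vopen) V *ᵥ (-v / V) = Pi.single j 1 := by
      rw [symmJacobian_mulVec_eq, h, mulVec_neg, neg_neg, hv, mulVec_mulVec,
        mul_nonsing_inv _ hJ, one_mulVec]
    have hx := (G.isLoadNetwork.symmJacobian_isZMatrixOn hV.1).pos_of_mulVec_nonneg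
      G.loads_connected hc hcoer (x := -v / V)
      (fun i => by rw [hS]; exact (Pi.single_nonneg.2 zero_le_one : (0 : Fin n → ℝ) ≤ _) i)
      (by rw [hS]; simp) i
    have h1 := mul_pos (hV.1 i) hx
    have h2 := congrFun h i
    simp only [Pi.mul_apply, Pi.neg_apply] at h2
    rw [h2] at h1
    simpa [hv] using neg_pos.1 h1

theorem closure_D : closure G.D = semistableSet G.YLL (G.YLL *ᵥ G.Vopen) := by
  rw [D_eq_stableSet, G.isLoadNetwork.closure_stableSet]

theorem setOf_isSemiStable : {V | ∃ P, G.IsSemiStable V P} = closure G.D := by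
  ext V
  constructor
  · rintro ⟨P, -, h⟩
    refine Metric.mem_closure_iff.2 fun ε hε => ?_
    obtain ⟨W, Q, hW, hlt⟩ := h ε hε
    refine ⟨W, ⟨Q, hW⟩, ?_⟩
    rw [dist_eq_norm]
    -- The ambient metric is the sup metric, dominated by the Euclidean one.
    refine lt_of_le_of_lt ((pi_norm_le_iff_of_nonneg (norm_nonneg _)).2 fun i => ?_) hlt
    exact PiLp.norm_apply_le (WithLp.toLp 2 (V - W)) i
  · intro hV
    have hpos : ∀ i, 0 < V i := (G.closure_D ▸ hV).1
    refine ⟨G.Pc V, G.isOperatingPoint_iff.2 ⟨hpos, rfl⟩, fun ε hε => ?_⟩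
    have hc : Continuous fun W : Fin n → ℝ => ‖WithLp.toLp 2 (V - W)‖ := by fun_prop
    obtain ⟨W, hW, Q, hQ⟩ := mem_closure_iff.1 hV _ (isOpen_Iio.preimage hc : IsOpen (_ ⁻¹' Iio ε))
      (by simpa using hε)
    exact ⟨W, Q, hQ, hW⟩

theorem injOn_Pc : InjOn G.Pc (closure G.D) := by
  rw [closure_D, Pc_eq_powerMap]
  exact G.isLoadNetwork.injOn_powerMap

theorem bijOn_Pc : BijOn G.Pc (closure G.D) G.F := by
  refine ⟨fun V hV => ?_, G.injOn_Pc, fun P hP => ?_⟩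
  · rw [closure_D] at hV
    exact G.mem_F_iff.2 ⟨V, hV.1, rfl⟩
  · obtain ⟨V, hV, rfl⟩ := G.mem_F_iff.1 hP
    rw [closure_D, Pc_eq_powerMap]
    exact G.isLoadNetwork.exists_mem_semistableSet hV fun i => le_rfl

theorem continuous_Pc : Continuous G.Pc := by
  rw [Pc_eq_powerMap]; exact continuous_powerMap _ _

theorem Pc_Vopen : G.Pc G.Vopen = 0 := by simp [Pc]

theorem Vopen_mem_D : G.Vopen ∈ G.D := by
  rw [D_eq_stableSet]
  exact G.isLoadNetwork.mem_stableSet_of_mulVec_eq rfl G.Vopen_pos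

theorem isOpen_D : IsOpen G.D := by
  rw [D_eq_stableSet]; exact IsLoadNetwork.isOpen_stableSet _ _

theorem isUnit_det_jacobian_of_mem_D {V : Fin n → ℝ} (hV : V ∈ G.D) :
    IsUnit (G.jacobian V).det := by
  rw [D_eq_stableSet] at hV
  exact G.isUnit_det_jacobian hV

/-- Near an interior point some strictly larger demand is feasible, which is impossible at a
singular semistable point. -/
theorem mem_D_of_mem_interior {V : Fin n → ℝ} (hV : V ∈ closure G.D)
    (hint : G.Pc V ∈ interior G.F) : V ∈ G.D := by
  have hlim : Filter.Tendsto (fun ε : ℝ => G.Pc V + ε • (1 : Fin n → ℝ))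
      (nhdsWithin 0 (Ioi 0)) (nhds (G.Pc V)) := by
    have : Continuous fun ε : ℝ => G.Pc V + ε • (1 : Fin n → ℝ) := by fun_prop
    simpa using (this.tendsto 0).mono_left nhdsWithin_le_nhds
  obtain ⟨ε, hε, hε0⟩ :=
    ((hlim.eventually (mem_interior_iff_mem_nhds.1 hint)).and self_mem_nhdsWithin).exists
  obtain ⟨W, -, hW⟩ := G.mem_F_iff.1 hε
  rw [closure_D] at hV
  rw [D_eq_stableSet]
  refine G.isLoadNetwork.mem_stableSet_of_forall_lt (W := W) hV fun i => ?_
  rw [← Pc_eq_powerMap, hW]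
  simpa using hε0

theorem mem_D_of_Pc_eq_smul {X P : Fin n → ℝ} (hP : P ∈ G.F) {t : ℝ} (ht : t ∈ Ico (0 : ℝ) 1)
    (hX : X ∈ closure G.D) (hfX : G.Pc X = t • P) : X ∈ G.D := by
  obtain ⟨W, -, hW⟩ := G.mem_F_iff.1 hP
  rw [closure_D] at hX
  rw [Pc_eq_powerMap] at hfX hW
  rw [D_eq_stableSet]
  exact G.isLoadNetwork.mem_stableSet_of_powerMap_eq_smul rfl G.Vopen_pos ⟨W, hW⟩ ht.2 ht.1 hX hfX

/-! ### The initial value problem -/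

/-- The semi-stable operating points along the segment from `0` to a feasible power demand. -/
theorem exists_path {P : Fin n → ℝ} (hP : P ∈ G.F) :
    ∃ γ : ℝ → Fin n → ℝ, ContinuousOn γ (Icc 0 1) ∧
      ∀ θ ∈ Icc (0 : ℝ) 1, γ θ ∈ closure G.D ∧ G.Pc (γ θ) = θ • P := by
  have hex : ∀ θ ∈ Icc (0 : ℝ) 1, ∃ X, X ∈ closure G.D ∧ G.Pc X = θ • P := fun θ hθ => by
    rw [closure_D, Pc_eq_powerMap]
    have h := G.mem_F_iff.1 hP
    rw [Pc_eq_powerMap] at h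
    exact G.isLoadNetwork.exists_powerMap_eq_smul rfl G.Vopen_pos h hθ
  choose! γ hγ using hex
  refine ⟨γ, ?_, hγ⟩
  set K : Set (Fin n → ℝ) := closure G.D ∩ G.Pc ⁻¹' ((fun θ : ℝ => θ • P) '' Icc 0 1) with hK
  have hKc : IsCompact K := by
    refine Metric.isCompact_of_isClosed_isBounded (isClosed_closure.inter ?_) ?_
    · exact (isCompact_Icc.image (by fun_prop)).isClosed.preimage G.continuous_Pc
    · obtain ⟨R, hR⟩ := G.isLoadNetwork.exists_bound (-|∑ i, P i|)
      refine (Metric.isBounded_closedBall (x := (0 : Fin n → ℝ)) (r := R)).subset fun V hV => ?_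
      rw [mem_closedBall_zero_iff]
      obtain ⟨-, θ, hθ, hθV⟩ := hV
      refine hR V ?_
      rw [← Pc_eq_powerMap, ← hθV]
      simp only [Pi.smul_apply, smul_eq_mul, ← Finset.mul_sum]
      have h1 := neg_abs_le (∑ i, P i)
      have h2 := abs_nonneg (∑ i, P i)
      nlinarith [hθ.1, hθ.2]
  have : CompactSpace K := isCompact_iff_compactSpace.1 hKc
  -- A continuous injection of a compact space into a Hausdorff one is an embedding, so `γ` inherits
  -- continuity from `θ • P`.
  have hemb : Topology.IsClosedEmbedding fun V : K => G.Pc V :=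
    (G.continuous_Pc.comp continuous_subtype_val).isClosedEmbedding fun V W h =>
      Subtype.ext (G.injOn_Pc V.2.1 W.2.1 h)
  have hmem : ∀ θ : Icc (0 : ℝ) 1, γ θ ∈ K := fun θ =>
    ⟨(hγ θ θ.2).1, θ, θ.2, (hγ θ θ.2).2.symm⟩
  have hg : Continuous fun θ : Icc (0 : ℝ) 1 => (⟨γ θ, hmem θ⟩ : K) := by
    rw [hemb.isInducing.continuous_iff]
    have : ((fun V : K => G.Pc V) ∘ fun θ : Icc (0 : ℝ) 1 => (⟨γ θ, hmem θ⟩ : K)) =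
        fun θ : Icc (0 : ℝ) 1 => (θ : ℝ) • P := funext fun θ => (hγ θ θ.2).2
    rw [this]
    fun_prop
  exact continuousOn_iff_continuous_domRestrict.2 (continuous_subtype_val.comp hg)

/-- A continuous lift of the segment from `0` to `P` along `P_c` satisfies the differential
equation where the Jacobian is nonsingular. -/
theorem solvesODEAt_of_lift {P : Fin n → ℝ} {γ : ℝ → Fin n → ℝ} (hc : ContinuousOn γ (Icc 0 1))
    (hγ : ∀ θ ∈ Icc (0 : ℝ) 1, G.Pc (γ θ) = θ • P) {θ : ℝ} (hθ : θ ∈ Icc (0 : ℝ) 1)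
    (hJ : IsUnit (G.jacobian (γ θ)).det) : G.SolvesODEAt P γ θ := by
  refine ⟨hJ, ?_⟩
  set J := G.jacobian (γ θ)
  let e : (Fin n → ℝ) ≃L[ℝ] (Fin n → ℝ) := ContinuousLinearEquiv.equivOfInverse
    (LinearMap.toContinuousLinearMap (Matrix.toLin' J))
    (LinearMap.toContinuousLinearMap (Matrix.toLin' J⁻¹))
    (fun x => by simp [mulVec_mulVec, nonsing_inv_mul _ hJ])
    (fun x => by simp [mulVec_mulVec, mul_nonsing_inv _ hJ])
  have hf : HasStrictFDerivAt G.Pc (e : (Fin n → ℝ) →L[ℝ] (Fin n → ℝ)) (γ θ) :=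
    G.hasStrictFDerivAt_Pc_jacobian (γ θ)
  have hinv := hf.to_localInverse.hasFDerivAt
  rw [hγ θ hθ] at hinv
  have hsmul : HasDerivWithinAt (fun t : ℝ => t • P) P (Icc 0 1) θ := by
    simpa using ((hasDerivAt_id θ).smul_const P).hasDerivWithinAt
  have hcomp := hinv.comp_hasDerivWithinAt θ hsmul
  -- Continuity of `γ` keeps it near `γ θ`, where the local inverse recovers it from `t • P`.
  have hev : ∀ᶠ t in nhdsWithin θ (Icc 0 1),
      γ t = (hf.localInverse G.Pc e (γ θ) ∘ fun t : ℝ => t • P) t := by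
    filter_upwards [(hc θ hθ).eventually hf.eventually_left_inverse, self_mem_nhdsWithin]
      with t ht htI
    rw [Function.comp_apply, ← hγ t htI, ht]
  exact hcomp.congr_of_eventuallyEq hev (hev.self_of_nhdsWithin hθ)

theorem IsIVPSolution.Pc_eq_smul {G : DCGrid n m} {P : Fin n → ℝ} {γ : ℝ → Fin n → ℝ}
    (h : G.IsIVPSolution P γ) : ∀ θ ∈ Icc (0 : ℝ) 1, G.Pc (γ θ) = θ • P := by
  have hconst := constant_of_has_deriv_right_zero (f := fun θ => G.Pc (γ θ) - θ • P) (a := 0) (b := 1)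
    ((G.continuous_Pc.comp_continuousOn h.continuousOn).sub (by fun_prop)) fun θ hθ => by
      obtain ⟨hJ, hd⟩ := h.ode θ hθ
      have h1 := (G.hasStrictFDerivAt_Pc_jacobian (γ θ)).hasFDerivAt.comp_hasDerivWithinAt θ hd
      have h2 : HasDerivWithinAt (fun t : ℝ => t • P) P (Icc 0 1) θ := by
        simpa using ((hasDerivAt_id θ).smul_const P).hasDerivWithinAt
      have h3 := (h1.sub h2).mono_of_mem_nhdsWithin (Icc_mem_nhdsGE_of_mem hθ)
      simpa [mulVec_mulVec, mul_nonsing_inv _ hJ, Function.comp_def, Pi.sub_def] using h3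
  intro θ hθ
  have := hconst θ hθ
  simpa [h.initial, Pc_Vopen, sub_eq_zero] using this

/-- `D` is open, and a point of `cl D` with nonsingular Jacobian is in `D`; so `D` is relatively
clopen in the connected image of `[0, 1)`. -/
theorem IsIVPSolution.mem_D {G : DCGrid n m} {P : Fin n → ℝ} {γ : ℝ → Fin n → ℝ}
    (h : G.IsIVPSolution P γ) {θ : ℝ} (hθ : θ ∈ Ico (0 : ℝ) 1) : γ θ ∈ G.D := by
  have hpre : IsPreconnected (γ '' Ico 0 1) :=
    isPreconnected_Ico.image _ (h.continuousOn.mono Ico_subset_Icc_self)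
  refine hpre.subset_of_closure_inter_subset G.isOpen_D
    ⟨γ 0, mem_image_of_mem _ (by simp), h.initial ▸ G.Vopen_mem_D⟩ ?_ (mem_image_of_mem _ hθ)
  rintro _ ⟨hV, θ, hθ, rfl⟩
  rw [closure_D] at hV
  rw [D_eq_stableSet]
  exact G.mem_stableSet_of_isUnit_det hV (h.ode θ hθ).1

end DCGrid

theorem theorem3 {n m : ℕ} (G : DCGrid n m) :
    -- the long-term voltage semi-stable operating points form the closure of `D`
    {V | ∃ P, G.IsSemiStable V P} = closure G.D ∧
    -- one-to-one correspondence
    Set.BijOn G.Pc (closure G.D) G.F ∧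
    (∀ P ∈ G.F, ∃! V, V ∈ closure G.D ∧ P = G.Pc V) ∧
    G.F = G.Pc '' closure G.D ∧
    -- the initial value problem
    (∀ P ∈ G.F, ∀ V ∈ closure G.D, P = G.Pc V →
      ∃ γ : ℝ → Fin n → ℝ, G.IsIVPSolution P γ ∧ γ 1 = V ∧
        (P ∈ interior G.F → G.SolvesODEAt P γ 1) ∧
        ∀ γ' : ℝ → Fin n → ℝ, G.IsIVPSolution P γ' → Set.EqOn γ' γ (Set.Icc 0 1)) := by
  refine ⟨G.setOf_isSemiStable, G.bijOn_Pc, fun P hP => ?_, G.bijOn_Pc.image_eq.symm,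
    fun P hP V hV hPV => ?_⟩
  · obtain ⟨V, hV, rfl⟩ := G.bijOn_Pc.surjOn hP
    exact ⟨V, ⟨hV, rfl⟩, fun W hW => G.injOn_Pc hW.1 hV hW.2.symm⟩
  · obtain ⟨γ, hc, hγ⟩ := G.exists_path hP
    have h1 : γ 1 = V := G.injOn_Pc (hγ 1 (by simp)).1 hV (by
      rw [(hγ 1 (by simp)).2, one_smul, hPV])
    have hlift : ∀ θ ∈ Icc (0 : ℝ) 1, G.Pc (γ θ) = θ • P := fun θ hθ => (hγ θ hθ).2
    refine ⟨γ, ⟨hc, ?_, fun θ hθ => ?_⟩, h1, fun hint => ?_, fun γ' hγ' => ?_⟩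
    · refine G.injOn_Pc (hγ 0 (by simp)).1 (subset_closure G.Vopen_mem_D) ?_
      rw [(hγ 0 (by simp)).2, G.Pc_Vopen, zero_smul]
    · have hθ' := Ico_subset_Icc_self hθ
      exact G.solvesODEAt_of_lift hc hlift hθ' (G.isUnit_det_jacobian_of_mem_D
        (G.mem_D_of_Pc_eq_smul hP hθ (hγ θ hθ').1 (hγ θ hθ').2))
    · refine G.solvesODEAt_of_lift hc hlift (by simp) (G.isUnit_det_jacobian_of_mem_D ?_)
      rw [h1]
      exact G.mem_D_of_mem_interior hV (hPV ▸ hint)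
    -- Injectivity settles `[0, 1)`; the endpoint, where the Jacobian may be singular, follows by
    -- continuity.
    · have hIco : EqOn γ' γ (Ico 0 1) := fun θ hθ => by
        have hθ' := Ico_subset_Icc_self hθ
        exact G.injOn_Pc (subset_closure (hγ'.mem_D hθ)) (hγ θ hθ').1
          ((hγ'.Pc_eq_smul θ hθ').trans (hγ θ hθ').2.symm)
      exact hIco.of_subset_closure hγ'.continuousOn hc Ico_subset_Icc_self
        (closure_Ico (zero_ne_one (α := ℝ))).ge
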